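/- **Setting.** Let $\tau>0$ (the sampling time) and let $A\subseteq\mathbb R$ be a non-empty set ($A=\{\alpha\}$ for one fixed constant $\alpha$, $A=\mathbb R$ for no restriction). A *subsystem* $K$ consists of $n_K\ge 1$ system qubits, labelled $1,\dots,n_K$, and one ancilla qubit, labelled $0$, with Hamiltonian $$H_K=\sum_{0\le j_1<j_2\le n_K}J_K^{j_1,j_2}\bigl(X^{(j_1)}X^{(j_2)}+Y^{(j_1)}Y^{(j_2)}\bigr)+\sum_{j=0}^{n_K}\alpha_K Z^{(j)},\qquad J_K^{j_1,j_2}\in\mathbb R,\ \alpha_K\in A,$$ and with the input-dependent channel, for $x\in[0,1]$, $$T_K(x)\rho=\mathrm{Tr}_{0}\Bigl(e^{-iH_K\tau}\,\bigl(\rho\otimes(x|0\rangle\langle 0|+(1-x)|1\rangle\langle 1|)\bigr)\,e^{iH_K\tau}\Bigr),$$ where $\mathrm{Tr}_0$ is the partial trace over the ancilla. A *system* consists of $N\ge1$ such non-interacting subsystems together with a real polynomial in the variables indexed by all $n=\sum_K n_K$ system qubits; it evolves on product states $\rho=\bigotimes_{K=1}^N\rho^K$ by $T(x)=\bigotimes_{K=1}^N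 T_K(x)$, and its output $h(\rho)$ is the value of the polynomial at the expectations $\langle Z^{(i)}\rangle=\mathrm{Tr}(\rho Z^{(i)})$, $i=1,\dots,n$. The system belongs to the class $\mathcal S$ if for each $K$ there is $0<\epsilon_K\le1$ such that for all $x\in[0,1]$ and all traceless Hermitian $B$ on the system qubits of $K$, $$\|T_K(x)B\|_2\le(1-\epsilon_K)\|B\|_2 ,$$ where $\|\cdot\|_2$ is the Hilbert–Schmidt norm. Let $K_1([0,1])$ and $K_1^-([0,1])$ be the sets of sequences with values in $[0,1]$ indexed by $\mathbb Z$ and by $\mathbb Z^-=\{\dots,-1,0\}$. The *filter* $M:K_1([0,1])\to\mathbb R^{\mathbb Z}$ induced by a system is $$M(u)_k=h\Bigl(\lim_{m\to\infty}T(u_k)T(u_{k-1})\cdots T(u_{k-m})\,\rho_{-\infty}\Bigr)$$ for every initial product state $\rho_{-\infty}$ of density operators, and the *functional* of a causal filter $M$ is $F(u)=M(\tilde u)_0$ for $u\in K_1^-([0,1])$ and any extension $\tilde u\in K_1([0,1])$ of $u$. A filter $M$ is *causal* if $M(u)_k$ depends only on $(u_l)_{l\le k}$, and *time-invariant* if it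 commutes with all shifts. Let $\mathcal M_S$ be the set of filters induced by the systems in $\mathcal S$, and $\mathcal F_S$ the set of their functionals. A *null sequence* is a decreasing sequence $w=(w_k)_{k\ge0}$ in $(0,1]$ with $w_k\to0$, and $\|u\|_w=\sup_{k\le0}|u_k|w_{-k}$. A causal time-invariant filter has the *$w$-fading memory property* if its functional is continuous on $K_1^-([0,1])$ for the distance $\|u-v\|_w$; $C(K_1^-([0,1]),\|\cdot\|_w)$ is the set of real functions on $K_1^-([0,1])$ that are continuous for this distance, with the supremum norm. **Proposition.** Every system in $\mathcal S$ induces exactly one filter (the limits above exist, and the output in the limit does not depend on the initial product state), and this filter is causal and time-invariant. For every null sequence $w$: 1. $\mathcal F_S\subseteq C(K_1^-([0,1]),\|\cdot\|_w)$; 2. $\mathcal F_S$ is dense in $C(K_1^-([0,1]),\|\cdot\|_w)$: for each $G$ in this space and each $\varepsilon>0$ there is $F\in\mathcal F_S$ with $|G(u)-F(u)|<\varepsilon$ for all $u\in K_1^-([0,1])$; 3. consequently the class is universal: for each causal time-invariant filter $M_*$ with the $w$-fading memory property and each $\varepsilon>0$ there is $M\in\mathcal M_S$ with $\sup_{k\in\mathbb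 Z}|M_*(u)_k-M(u)_k|<\varepsilon$ for all $u\in K_1([0,1])$. -/

import Mathlib

open Filter Topology
open scoped ComplexOrder

noncomputable section

/-! ### Operators on qubit registers -/

/-- Square complex matrices indexed by `ι`, i.e. operators on the Hilbert space `ℂ^ι`. -/
abbrev Op (ι : Type) : Type := Matrix ι ι ℂ

/-- The computational basis of an `m`-qubit register. -/
abbrev Reg (m : ℕ) : Type := Fin m → Fin 2

def pauliX : Op (Fin 2) := !![0, 1; 1, 0]

def pauliY : Op (Fin 2) := !![0, -Complex.I; Complex.I, 0]

def pauliZ : Op (Fin 2) := !![1, 0; 0, -1]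

/-- The operator `I ⊗ ⋯ ⊗ P ⊗ ⋯ ⊗ I` on `⨂ i, ℂ^(κ i)`, with `P` acting on the factor `i`. -/
def atSite {ι : Type} [Fintype ι] [DecidableEq ι] {κ : ι → Type} [∀ i, DecidableEq (κ i)]
    (i : ι) (P : Op (κ i)) : Op (∀ i, κ i) :=
  fun a b => if ∀ j, j ≠ i → a j = b j then P (a i) (b i) else 0

/-- The tensor product `⨂ i, ρ i`, as an operator on `⨂ i, ℂ^(κ i)`. -/
def tensorOp {ι : Type} [Fintype ι] {κ : ι → Type} (ρ : ∀ i, Op (κ i)) : Op (∀ i, κ i) :=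
  fun a b => ∏ i, ρ i (a i) (b i)

/-- The Hilbert–Schmidt (Schatten `2`-) norm, `(Tr (A* A))^(1/2)`. -/
def hsNorm {ι : Type} [Fintype ι] (A : Op ι) : ℝ :=
  Real.sqrt (A.conjTranspose * A).trace.re

/-- Density operators: positive semidefinite operators of trace one. -/
def IsDensity {ι : Type} [Fintype ι] (ρ : Op ι) : Prop :=
  ρ.PosSemidef ∧ ρ.trace = 1

/-! ### A subsystem: system qubits and one ancilla qubit -/

/-- The parameters of a subsystem. Its `n + 1` qubits are indexed by `Fin (n + 1)`; the qubit `0`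
is the ancilla and the qubits `1, …, n` are the system qubits. Only the couplings `J j₁ j₂` with
`j₁ < j₂` are used. -/
structure Subsystem where
  n : ℕ
  n_pos : 0 < n
  J : Fin (n + 1) → Fin (n + 1) → ℝ
  α : ℝ

namespace Subsystem

/-- `H = ∑_{j₁ < j₂} J^{j₁,j₂} (X^{(j₁)} X^{(j₂)} + Y^{(j₁)} Y^{(j₂)}) + ∑_j α Z^{(j)}`. -/
def hamiltonian (s : Subsystem) : Op (Reg (s.n + 1)) :=
  (∑ j₁, ∑ j₂ ∈ Finset.Ioi j₁, (s.J j₁ j₂ : ℂ) •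
      (atSite j₁ pauliX * atSite j₂ pauliX + atSite j₁ pauliY * atSite j₂ pauliY)) +
    ∑ j, (s.α : ℂ) • atSite j pauliZ

end Subsystem

/-- The ancilla state `u |0⟩⟨0| + (1 - u) |1⟩⟨1|`. -/
def ancillaState (u : unitInterval) : Op (Fin 2) :=
  !![((u : ℝ) : ℂ), 0; 0, 1 - ((u : ℝ) : ℂ)]

/-- The joint operator `ρ ⊗ σ` of the system qubits (operator `ρ`) and the ancilla
(operator `σ`, on the qubit `0`). -/
def attachAncilla {n : ℕ} (ρ : Op (Reg n)) (σ : Op (Fin 2)) : Op (Reg (n + 1)) :=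
  fun a b => ρ (fun i => a i.succ) (fun i => b i.succ) * σ (a 0) (b 0)

/-- The partial trace over the ancilla qubit `0`. -/
def traceAncilla {n : ℕ} (M : Op (Reg (n + 1))) : Op (Reg n) :=
  fun a b => ∑ c : Fin 2, M (Matrix.vecCons c a) (Matrix.vecCons c b)

namespace Subsystem

/-- `T(u) ρ = Tr_ancilla (e^{-iHτ} (ρ ⊗ (u |0⟩⟨0| + (1 - u) |1⟩⟨1|)) e^{iHτ})`. -/
def channel (s : Subsystem) (τ : ℝ) (u : unitInterval) (ρ : Op (Reg s.n)) : Op (Reg s.n) :=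
  traceAncilla
    (NormedSpace.exp (-(Complex.I * (τ : ℂ)) • s.hamiltonian) *
      attachAncilla ρ (ancillaState u) *
      NormedSpace.exp ((Complex.I * (τ : ℂ)) • s.hamiltonian))

/-- There is `0 < ε ≤ 1` such that, for every `u ∈ [0, 1]`, the restriction of `T(u)` to the
traceless Hermitian operators has operator norm at most `1 - ε` for the Hilbert–Schmidt norm. -/
def IsContractive (s : Subsystem) (τ : ℝ) : Prop :=
  ∃ ε : ℝ, 0 < ε ∧ ε ≤ 1 ∧ ∀ u : unitInterval, ∀ A : Op (Reg s.n),
    A.IsHermitian → A.trace = 0 → hsNorm (s.channel τ u A) ≤ (1 - ε) * hsNorm A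

/-- `T(u_k) T(u_{k-1}) ⋯ T(u_{k-m}) ρ`. -/
def evolve (s : Subsystem) (τ : ℝ) (u : ℤ → unitInterval) (k : ℤ) :
    ℕ → Op (Reg s.n) → Op (Reg s.n)
  | 0, ρ => s.channel τ (u k) ρ
  | m + 1, ρ => s.evolve τ u k m (s.channel τ (u (k - (m + 1 : ℕ))) ρ)

end Subsystem

/-! ### Systems of non-interacting subsystems with polynomial output -/

/-- `N ≥ 1` non-interacting subsystems, and a real polynomial in one variable for each system
qubit; the system qubit `j` of the subsystem `K` has the label `⟨K, j⟩`. -/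
structure QSystem where
  N : ℕ
  N_pos : 0 < N
  sub : Fin N → Subsystem
  poly : MvPolynomial (Σ K : Fin N, Fin (sub K).n) ℝ

namespace QSystem

/-- The computational basis of all system qubits, grouped by subsystems. -/
abbrev Basis (S : QSystem) : Type := ∀ K : Fin S.N, Reg (S.sub K).n

/-- The expectation `⟨Z^{(i)}⟩ = Tr (ρ Z^{(i)})` for a system qubit `i`. -/
def expZ (S : QSystem) (ρ : Op S.Basis) (i : Σ K : Fin S.N, Fin (S.sub K).n) : ℝ :=
  (ρ * atSite (κ := fun K => Reg (S.sub K).n) i.1 (atSite i.2 pauliZ)).trace.re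

/-- The output functional `h`: the polynomial evaluated at the expectations `⟨Z^{(i)}⟩`. -/
def output (S : QSystem) (ρ : Op S.Basis) : ℝ :=
  MvPolynomial.eval (S.expZ ρ) S.poly

/-- The state `T(u_k) T(u_{k-1}) ⋯ T(u_{k-m}) ρ` of the whole system, where `T = ⨂_K T_K` and
where `ρ = ⨂_K ρ_K` is a product operator. -/
def state (S : QSystem) (τ : ℝ) (u : ℤ → unitInterval) (k : ℤ) (m : ℕ)
    (ρ : ∀ K, Op (Reg (S.sub K).n)) : Op S.Basis :=
  tensorOp (κ := fun K => Reg (S.sub K).n) fun K => (S.sub K).evolve τ u k m (ρ K)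

/-- `M` is the filter induced by the system: for every input `u`, every time `k` and every initial
product state `ρ = ⨂_K ρ_K`, the limit of `T(u_k) T(u_{k-1}) ⋯ T(u_{k-m}) ρ` as `m → ∞` exists,
and `M(u)_k` is the output in the limit. -/
def Induces (S : QSystem) (τ : ℝ) (M : (ℤ → unitInterval) → ℤ → ℝ) : Prop :=
  ∀ (u : ℤ → unitInterval) (k : ℤ) (ρ : ∀ K, Op (Reg (S.sub K).n)), (∀ K, IsDensity (ρ K)) →
    ∃ ρlim : Op S.Basis,
      Tendsto (fun m : ℕ => S.state τ u k m ρ) atTop (𝓝 ρlim) ∧ M u k = S.output ρlim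

/-- The systems of the class: every subsystem is strictly contractive and has its constant `α`
in the set `A`. -/
def InClass (S : QSystem) (τ : ℝ) (A : Set ℝ) : Prop :=
  ∀ K, (S.sub K).α ∈ A ∧ (S.sub K).IsContractive τ

end QSystem

/-! ### Filters and functionals -/

/-- `M(u)_k` depends only on the inputs up to time `k`. -/
def IsCausal (M : (ℤ → unitInterval) → ℤ → ℝ) : Prop :=
  ∀ (u v : ℤ → unitInterval) (k : ℤ), (∀ l, l ≤ k → u l = v l) → M u k = M v k

/-- `M` commutes with all time shifts. -/
def IsTimeInvariant (M : (ℤ → unitInterval) → ℤ → ℝ) : Prop :=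
  ∀ (u : ℤ → unitInterval) (t k : ℤ), M (fun l => u (l - t)) k = M u (k - t)

/-- The index set `ℤ⁻ = {…, -1, 0}`. -/
abbrev NonposInt : Type := Set.Iic (0 : ℤ)

/-- The extension of an input on `ℤ⁻` to `ℤ`, by `0` at positive times. -/
def extendInput (u : NonposInt → unitInterval) : ℤ → unitInterval :=
  fun k => if h : k ≤ 0 then u ⟨k, h⟩ else 0

/-- The functional `F(u) = M(u)_0` of a causal filter `M`, on inputs indexed by `ℤ⁻`. -/
def functionalOf (M : (ℤ → unitInterval) → ℤ → ℝ) (u : NonposInt → unitInterval) : ℝ :=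
  M (extendInput u) 0

/-- The set of filters induced by the systems of the class. -/
def inducedFilters (τ : ℝ) (A : Set ℝ) : Set ((ℤ → unitInterval) → ℤ → ℝ) :=
  {M | ∃ S : QSystem, S.InClass τ A ∧ S.Induces τ M}

/-- The corresponding family of functionals. -/
def inducedFunctionals (τ : ℝ) (A : Set ℝ) : Set ((NonposInt → unitInterval) → ℝ) :=
  functionalOf '' inducedFilters τ A

/-! ### The weighted norm -/

/-- A null sequence: a decreasing sequence in `(0, 1]` that tends to `0`. -/
structure NullSequence where
  val : ℕ → ℝ
  pos : ∀ k, 0 < val k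
  le_one : ∀ k, val k ≤ 1
  anti : Antitone val
  lim : Tendsto val atTop (𝓝 0)

/-- `‖u‖_w = sup_{k ≤ 0} |u_k| w_{-k}`. -/
def weightedNorm (w : NullSequence) (u : NonposInt → ℝ) : ℝ :=
  ⨆ k : NonposInt, |u k| * w.val (-(k : ℤ)).toNat

/-- The space `(K_1^-([0, 1]), ‖·‖_w)` of inputs `ℤ⁻ → [0, 1]`, with the distance
`‖u - v‖_w`. -/
@[ext]
structure PastInput (w : NullSequence) where
  seq : NonposInt → unitInterval

namespace PastInput

variable {w : NullSequence}

instance : Dist (PastInput w) where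
  dist u v := weightedNorm w fun k => (u.seq k : ℝ) - v.seq k

theorem dist_def (u v : PastInput w) :
    dist u v = ⨆ k : NonposInt, |(u.seq k : ℝ) - v.seq k| * w.val (-(k : ℤ)).toNat := rfl

theorem le_dist (u v : PastInput w) (k : NonposInt) :
    |(u.seq k : ℝ) - v.seq k| * w.val (-(k : ℤ)).toNat ≤ dist u v := by
  refine le_ciSup (f := fun k : NonposInt =>
    |(u.seq k : ℝ) - v.seq k| * w.val (-(k : ℤ)).toNat) ⟨1, ?_⟩ k
  rintro _ ⟨j, rfl⟩
  have h1 : |(u.seq j : ℝ) - v.seq j| ≤ 1 := by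
    rw [abs_le]
    constructor <;> linarith [(u.seq j).2.1, (u.seq j).2.2, (v.seq j).2.1, (v.seq j).2.2]
  exact mul_le_one₀ h1 (w.pos _).le (w.le_one _)

instance : MetricSpace (PastInput w) where
  dist_self u := by simp [dist_def]
  dist_comm u v := by simp only [dist_def, abs_sub_comm]
  dist_triangle u v z := by
    have : Nonempty NonposInt := ⟨⟨0, Set.mem_Iic.mpr le_rfl⟩⟩
    refine ciSup_le fun k => le_trans ?_ (add_le_add (le_dist u v k) (le_dist v z k))
    rw [← add_mul]
    exact mul_le_mul_of_nonneg_right (abs_sub_le _ _ _) (w.pos _).le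
  eq_of_dist_eq_zero {u v} h := by
    ext k
    have h1 := le_dist u v k
    rw [h] at h1
    have h2 : |(u.seq k : ℝ) - v.seq k| ≤ 0 := by
      by_contra hc
      exact absurd (mul_pos (not_le.mp hc) (w.pos _)) (not_lt.mpr h1)
    exact sub_eq_zero.mp (abs_nonpos_iff.mp h2)

end PastInput

/-- A filter has the `w`-fading memory property if its functional is `‖·‖_w`-continuous. -/
def HasFadingMemory (w : NullSequence) (M : (ℤ → unitInterval) → ℤ → ℝ) : Prop :=
  Continuous fun u : PastInput w => functionalOf M u.seq

end

/-! Existence and continuity come from contraction, density from Stone–Weierstrass on a compact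
space.

Channels preserve trace and Hermiticity, so a difference of two initial states is traceless
Hermitian and shrinks by `1 - ε` at every step. Prepending one more past input therefore changes the
state by a geometrically small amount: the limit exists and forgets the initial state. The bound is
uniform in the input (`IsContractive.exists_uniform_bound`), so the limit state is a uniform limit
of functions of finitely many inputs, hence continuous in the input. Causality and time invariance
hold for the finite products and pass to the limit.

The weighted distance is continuous for the product topology on `[0,1]^(ℤ⁻)`, so `PastInput w` is
compact by Tychonoff (`PastInput.continuous_mk`). By Stone–Weierstrass it is enough to find, among
the induced functionals, an algebra that separates points. Subsystems with one system qubit are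
enough. Their Hamiltonian can be exponentiated explicitly (`exp_exchangeOp`), and with `q =
cos²(2Jτ)` the expectation `z_k` of `Z` obeys `z_k = q z_{k-1} + (1 - q)(2 u_k - 1)`
(`qubitOutput_eq`). For small `q > 0` the most recent difference between two inputs outweighs
everything older, so their outputs differ (`exists_qubitOutput_ne`). A polynomial in finitely many
such outputs is the output of these qubits run in parallel (`exists_filter_of_mem_adjoin`), so the
generated algebra consists of induced functionals. The value of `α` plays no role here, so any
element of `A` will do.

Universality for filters follows since a causal time-invariant filter is determined by its
functional. -/

/-! ### Tensor products of operators -/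

section TensorOp

variable {ι : Type} [Fintype ι] [DecidableEq ι] {κ : ι → Type}

theorem tensorOp_mul [∀ i, Fintype (κ i)] (ρ σ : ∀ i, Op (κ i)) :
    tensorOp ρ * tensorOp σ = tensorOp fun i => ρ i * σ i := by
  ext a b
  simp only [tensorOp, Matrix.mul_apply, ← Finset.prod_mul_distrib]
  exact (Fintype.prod_sum fun i c => ρ i (a i) c * σ i c (b i)).symm

theorem trace_tensorOp [∀ i, Fintype (κ i)] (ρ : ∀ i, Op (κ i)) :
    (tensorOp ρ).trace = ∏ i, (ρ i).trace := by
  simp only [tensorOp, Matrix.trace, Matrix.diag_apply]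
  exact (Fintype.prod_sum fun i c => ρ i c c).symm

theorem atSite_eq_tensorOp [∀ i, DecidableEq (κ i)] (i : ι) (P : Op (κ i)) :
    atSite i P = tensorOp (Function.update (fun _ => 1) i P) := by
  ext a b
  rw [atSite, tensorOp, ← Finset.mul_prod_erase _ _ (Finset.mem_univ i)]
  simp only [Function.update_self]
  split_ifs with h
  · rw [Finset.prod_eq_one, mul_one]
    intro j hj
    have hj := Finset.ne_of_mem_erase hj
    rw [Function.update_of_ne hj, h j hj, Matrix.one_apply_eq]
  · push Not at h
    obtain ⟨j, hj, hab⟩ := h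
    rw [Finset.prod_eq_zero (Finset.mem_erase.2 ⟨hj, Finset.mem_univ j⟩), mul_zero]
    rw [Function.update_of_ne hj, Matrix.one_apply_ne hab]

theorem commute_atSite [∀ i, DecidableEq (κ i)] [∀ i, Fintype (κ i)] {i j : ι} (hij : i ≠ j)
    (P : Op (κ i)) (Q : Op (κ j)) : Commute (atSite i P) (atSite j Q) := by
  simp only [Commute, SemiconjBy, atSite_eq_tensorOp, tensorOp_mul]
  congr 1
  funext l
  by_cases hi : l = i
  · subst hi
    simp [Function.update_of_ne hij]
  · simp [Function.update_of_ne hi]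

/-- The trace factorises over the sites, and every site other than `i` contributes 1. Thus a local
expectation in a product state sees only its own subsystem. -/
theorem trace_tensorOp_mul_atSite [∀ i, DecidableEq (κ i)] [∀ i, Fintype (κ i)]
    (ρ : ∀ i, Op (κ i)) (i : ι) (P : Op (κ i)) (hρ : ∀ j, j ≠ i → (ρ j).trace = 1) :
    (tensorOp ρ * atSite i P).trace = (ρ i * P).trace := by
  rw [atSite_eq_tensorOp, tensorOp_mul, trace_tensorOp,
    Finset.prod_eq_single i (fun j _ hj => ?_) (by simp), Function.update_self]
  rw [Function.update_of_ne hj, mul_one, hρ j hj]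

theorem isHermitian_atSite [∀ i, DecidableEq (κ i)] (i : ι) {P : Op (κ i)} (hP : P.IsHermitian) :
    (atSite i P).IsHermitian := by
  ext a b
  simp only [Matrix.conjTranspose_apply, atSite, eq_comm (a := b _)]
  split_ifs
  · exact hP.apply _ _
  · simp

end TensorOp

theorem continuous_tensorOp {ι : Type} [Fintype ι] {κ : ι → Type} :
    Continuous (tensorOp (κ := κ)) := by
  refine continuous_matrix fun a b => continuous_finsetProd _ fun i _ => ?_
  exact (continuous_apply i).matrix_elem _ _


/-! ### The Hilbert–Schmidt norm -/

section HsNorm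

variable {ι : Type} [Fintype ι]

theorem hsNorm_eq (A : Op ι) : hsNorm A = Real.sqrt (∑ j, ∑ i, ‖A i j‖ ^ 2) := by
  simp only [hsNorm, Matrix.trace, Matrix.diag_apply, Matrix.mul_apply,
    Matrix.conjTranspose_apply, Complex.re_sum]
  congr 1
  refine Finset.sum_congr rfl fun j _ => Finset.sum_congr rfl fun i _ => ?_
  rw [RCLike.star_def, ← Complex.normSq_eq_conj_mul_self, Complex.ofReal_re,
    Complex.normSq_eq_norm_sq]

theorem hsNorm_nonneg (A : Op ι) : 0 ≤ hsNorm A := Real.sqrt_nonneg _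

/-- Turns Hilbert–Schmidt estimates into entrywise ones, the form in which convergence of matrices
is handled below. -/
theorem norm_entry_le_hsNorm (A : Op ι) (i j : ι) : ‖A i j‖ ≤ hsNorm A := by
  rw [hsNorm_eq]
  refine Real.le_sqrt_of_sq_le ?_
  refine le_trans ?_ (Finset.single_le_sum (f := fun j => ∑ i, ‖A i j‖ ^ 2)
    (fun _ _ => Finset.sum_nonneg fun _ _ => sq_nonneg _) (Finset.mem_univ j))
  exact Finset.single_le_sum (f := fun i => ‖A i j‖ ^ 2)
    (fun _ _ => sq_nonneg _) (Finset.mem_univ i)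

theorem continuous_hsNorm : Continuous (hsNorm (ι := ι)) := by
  unfold hsNorm
  fun_prop

end HsNorm

/-! ### The channel of a subsystem -/

theorem sum_reg_succ {n : ℕ} {M : Type*} [AddCommMonoid M] (f : Reg (n + 1) → M) :
    ∑ a, f a = ∑ a : Reg n, ∑ c : Fin 2, f (Matrix.vecCons c a) := by
  rw [← (Fin.consEquiv fun _ : Fin (n + 1) => Fin 2).sum_comp, Fintype.sum_prod_type,
    Finset.sum_comm]
  rfl

section Ancilla

variable {n : ℕ}

theorem trace_traceAncilla (M : Op (Reg (n + 1))) : (traceAncilla M).trace = M.trace := by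
  simp only [Matrix.trace, Matrix.diag_apply, traceAncilla, sum_reg_succ]

theorem trace_attachAncilla (ρ : Op (Reg n)) (σ : Op (Fin 2)) :
    (attachAncilla ρ σ).trace = ρ.trace * σ.trace := by
  simp only [Matrix.trace, Matrix.diag_apply, attachAncilla, sum_reg_succ, Finset.sum_mul_sum,
    Matrix.cons_val_succ, Matrix.cons_val_zero]

theorem conjTranspose_traceAncilla (M : Op (Reg (n + 1))) :
    (traceAncilla M).conjTranspose = traceAncilla M.conjTranspose := by
  ext a b
  simp [traceAncilla, Matrix.conjTranspose_apply]

theorem conjTranspose_attachAncilla (ρ : Op (Reg n)) (σ : Op (Fin 2)) :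
    (attachAncilla ρ σ).conjTranspose = attachAncilla ρ.conjTranspose σ.conjTranspose := by
  ext a b
  simp [attachAncilla, Matrix.conjTranspose_apply]

theorem traceAncilla_sub (M M' : Op (Reg (n + 1))) :
    traceAncilla (M - M') = traceAncilla M - traceAncilla M' := by
  ext a b
  simp [traceAncilla]

theorem attachAncilla_sub (ρ ρ' : Op (Reg n)) (σ : Op (Fin 2)) :
    attachAncilla (ρ - ρ') σ = attachAncilla ρ σ - attachAncilla ρ' σ := by
  ext a b
  simp [attachAncilla, sub_mul]

theorem continuous_traceAncilla : Continuous (traceAncilla (n := n)) :=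
  continuous_matrix fun _ _ => continuous_finsetSum _ fun _ _ =>
    continuous_id.matrix_elem _ _

theorem trace_ancillaState (u : unitInterval) : (ancillaState u).trace = 1 := by
  simp [ancillaState, Matrix.trace_fin_two]

theorem isHermitian_ancillaState (u : unitInterval) : (ancillaState u).IsHermitian := by
  ext i j
  fin_cases i <;> fin_cases j <;> simp [ancillaState, Complex.conj_ofReal]

theorem continuous_ancillaState : Continuous ancillaState := by
  refine continuous_matrix fun i j => ?_
  fin_cases i <;> fin_cases j <;> simp [ancillaState] <;> fun_prop

theorem continuous_attachAncilla :
    Continuous fun p : Op (Reg n) × Op (Fin 2) => attachAncilla p.1 p.2 :=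
  continuous_matrix fun _ _ =>
    (continuous_fst.matrix_elem _ _).mul (continuous_snd.matrix_elem _ _)

end Ancilla

theorem isHermitian_pauliX : pauliX.IsHermitian := by
  ext i j
  fin_cases i <;> fin_cases j <;> simp [pauliX]

theorem isHermitian_pauliY : pauliY.IsHermitian := by
  ext i j
  fin_cases i <;> fin_cases j <;> simp [pauliY]

theorem isHermitian_pauliZ : pauliZ.IsHermitian := by
  ext i j
  fin_cases i <;> fin_cases j <;> simp [pauliZ]

namespace Subsystem

variable (s : Subsystem) (τ : ℝ)

theorem isHermitian_hamiltonian : s.hamiltonian.IsHermitian := by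
  have hsum {ι' : Type} (t : Finset ι') {f : ι' → Op (Reg (s.n + 1))}
      (hf : ∀ i ∈ t, (f i).IsHermitian) : (∑ i ∈ t, f i).IsHermitian := by
    rw [Matrix.IsHermitian, Matrix.conjTranspose_sum]
    exact Finset.sum_congr rfl hf
  have hsmul (r : ℝ) {B : Op (Reg (s.n + 1))} (hB : B.IsHermitian) :
      ((r : ℂ) • B).IsHermitian := by
    rw [Matrix.IsHermitian, Matrix.conjTranspose_smul, hB.eq, RCLike.star_def, Complex.conj_ofReal]
  have hmul (j₁ j₂ : Fin (s.n + 1)) (h : j₁ ≠ j₂) {P : Op (Fin 2)} (hP : P.IsHermitian) :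
      (atSite (κ := fun _ => Fin 2) j₁ P * atSite j₂ P).IsHermitian := by
    rw [Matrix.IsHermitian, Matrix.conjTranspose_mul,
      (isHermitian_atSite (κ := fun _ => Fin 2) j₁ hP).eq,
      (isHermitian_atSite (κ := fun _ => Fin 2) j₂ hP).eq]
    exact (commute_atSite (κ := fun _ => Fin 2) h P P).eq.symm
  refine (hsum _ fun j₁ _ => hsum _ fun j₂ hj => hsmul _ ?_).add
    (hsum _ fun j _ => hsmul _ (isHermitian_atSite (κ := fun _ => Fin 2) _ isHermitian_pauliZ))
  -- A product of two Hermitian operators is Hermitian because operators at distinct sites commute.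
  have hne : j₁ ≠ j₂ := (Finset.mem_Ioi.1 hj).ne
  exact (hmul _ _ hne isHermitian_pauliX).add (hmul _ _ hne isHermitian_pauliY)

theorem conjTranspose_exp_hamiltonian (c : ℂ) :
    (NormedSpace.exp (c • s.hamiltonian)).conjTranspose =
      NormedSpace.exp (star c • s.hamiltonian) := by
  rw [← Matrix.exp_conjTranspose, Matrix.conjTranspose_smul, s.isHermitian_hamiltonian.eq]

theorem exp_mul_exp_neg_hamiltonian (c : ℂ) :
    NormedSpace.exp (c • s.hamiltonian) * NormedSpace.exp (-c • s.hamiltonian) = 1 := by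
  rw [← Matrix.exp_add_of_commute (𝔸 := ℂ) (c • s.hamiltonian) (-c • s.hamiltonian)
    (((Commute.refl _).smul_left _).smul_right _), ← add_smul]
  simp

theorem channel_sub (u : unitInterval) (ρ σ : Op (Reg s.n)) :
    s.channel τ u (ρ - σ) = s.channel τ u ρ - s.channel τ u σ := by
  simp only [channel, attachAncilla_sub, mul_sub, sub_mul, traceAncilla_sub]

theorem trace_channel (u : unitInterval) (ρ : Op (Reg s.n)) :
    (s.channel τ u ρ).trace = ρ.trace := by
  rw [channel, trace_traceAncilla, Matrix.trace_mul_comm, ← mul_assoc,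
    exp_mul_exp_neg_hamiltonian, one_mul, trace_attachAncilla, trace_ancillaState, mul_one]

theorem isHermitian_channel (u : unitInterval) {ρ : Op (Reg s.n)} (hρ : ρ.IsHermitian) :
    (s.channel τ u ρ).IsHermitian := by
  rw [Matrix.IsHermitian, channel, conjTranspose_traceAncilla, Matrix.conjTranspose_mul,
    Matrix.conjTranspose_mul, conjTranspose_exp_hamiltonian, conjTranspose_exp_hamiltonian,
    conjTranspose_attachAncilla, hρ.eq, (isHermitian_ancillaState u).eq, mul_assoc]
  simp

theorem continuous_channel {X : Type*} [TopologicalSpace X] {u : X → unitInterval}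
    {ρ : X → Op (Reg s.n)} (hu : Continuous u) (hρ : Continuous ρ) :
    Continuous fun x => s.channel τ (u x) (ρ x) :=
  continuous_traceAncilla.comp ((continuous_const.mul (continuous_attachAncilla.comp
    (hρ.prodMk (continuous_ancillaState.comp hu)))).mul continuous_const)

end Subsystem

namespace Subsystem

variable (s : Subsystem) (τ : ℝ)

/-! ### Iterating the channel -/

/-- The recursion defining `evolve` splits off the oldest input; this one splits off the newest,
which gives a recursion in `k`. -/
theorem evolve_succ (u : ℤ → unitInterval) (k : ℤ) (m : ℕ) (ρ : Op (Reg s.n)) :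
    s.evolve τ u k (m + 1) ρ = s.channel τ (u k) (s.evolve τ u (k - 1) m ρ) := by
  induction m generalizing ρ with
  | zero => simp [evolve]
  | succ m ih =>
    rw [evolve, ih, evolve]
    congr 4
    push_cast
    ring

theorem evolve_sub (u : ℤ → unitInterval) (k : ℤ) (m : ℕ) (ρ σ : Op (Reg s.n)) :
    s.evolve τ u k m (ρ - σ) = s.evolve τ u k m ρ - s.evolve τ u k m σ := by
  induction m generalizing ρ σ with
  | zero => exact s.channel_sub τ _ ρ σ
  | succ m ih => simp only [evolve, channel_sub, ih]

theorem trace_evolve (u : ℤ → unitInterval) (k : ℤ) (m : ℕ) (ρ : Op (Reg s.n)) :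
    (s.evolve τ u k m ρ).trace = ρ.trace := by
  induction m generalizing ρ with
  | zero => exact s.trace_channel τ _ ρ
  | succ m ih => simp only [evolve, trace_channel, ih]

theorem evolve_congr {u v : ℤ → unitInterval} {k : ℤ} (h : ∀ l, l ≤ k → u l = v l) (m : ℕ)
    (ρ : Op (Reg s.n)) : s.evolve τ u k m ρ = s.evolve τ v k m ρ := by
  induction m generalizing ρ with
  | zero => simp only [evolve, h k le_rfl]
  | succ m ih =>
    have h' := h (k - (m + 1 : ℕ)) (by omega)
    simp only [evolve, ih, h']

theorem evolve_shift (u : ℤ → unitInterval) (t k : ℤ) (m : ℕ) (ρ : Op (Reg s.n)) :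
    s.evolve τ (fun l => u (l - t)) k m ρ = s.evolve τ u (k - t) m ρ := by
  induction m generalizing ρ with
  | zero => rfl
  | succ m ih =>
    have h : k - (m + 1 : ℕ) - t = k - t - (m + 1 : ℕ) := by ring
    simp only [evolve, ih, h]

theorem continuous_evolve {X : Type*} [TopologicalSpace X] {u : X → ℤ → unitInterval} {k : ℤ}
    (hu : ∀ l, l ≤ k → Continuous fun x => u x l) (m : ℕ) {ρ : X → Op (Reg s.n)}
    (hρ : Continuous ρ) : Continuous fun x => s.evolve τ (u x) k m (ρ x) := by
  induction m generalizing ρ with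
  | zero => exact s.continuous_channel τ (hu k le_rfl) hρ
  | succ m ih => exact ih (s.continuous_channel τ (hu (k - (m + 1 : ℕ)) (by omega)) hρ)

/-- The contraction can be iterated because the channel keeps operators traceless and Hermitian. -/
theorem hsNorm_evolve_le {r : ℝ} (hr : 0 ≤ r)
    (h : ∀ u : unitInterval, ∀ B : Op (Reg s.n), B.IsHermitian → B.trace = 0 →
      hsNorm (s.channel τ u B) ≤ r * hsNorm B)
    (u : ℤ → unitInterval) (k : ℤ) (m : ℕ) {B : Op (Reg s.n)} (hB : B.IsHermitian)
    (hB₀ : B.trace = 0) : hsNorm (s.evolve τ u k m B) ≤ r ^ (m + 1) * hsNorm B := by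
  induction m generalizing B with
  | zero => simpa [evolve] using h (u k) B hB hB₀
  | succ m ih =>
    refine (ih (s.isHermitian_channel τ _ hB) ((s.trace_channel τ _ B).trans hB₀)).trans ?_
    rw [pow_succ r (m + 1), mul_assoc]
    exact mul_le_mul_of_nonneg_left (h _ B hB hB₀) (pow_nonneg hr _)

end Subsystem

/-! ### Limit states -/

/-- The maximally mixed state of an `n`-qubit register. -/
noncomputable def maxMixed (n : ℕ) : Op (Reg n) := ((2 : ℂ) ^ n)⁻¹ • 1

theorem trace_maxMixed (n : ℕ) : (maxMixed n).trace = 1 := by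
  simp [maxMixed, Matrix.trace_smul]

theorem isDensity_maxMixed (n : ℕ) : IsDensity (maxMixed n) := by
  refine ⟨Matrix.PosSemidef.one.smul ?_, trace_maxMixed n⟩
  have : ((2 : ℂ) ^ n)⁻¹ = (((2 : ℝ) ^ n)⁻¹ : ℝ) := by push_cast; rfl
  rw [this, Complex.zero_le_real]
  positivity

namespace Subsystem

variable (s : Subsystem) (τ : ℝ)

/-- The entrywise limit of `T(u_k) ⋯ T(u_{k-m}) ρ` for the maximally mixed state `ρ`. -/
noncomputable def limitState (u : ℤ → unitInterval) (k : ℤ) : Op (Reg s.n) :=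
  fun a b => limUnder atTop fun m => s.evolve τ u k m (maxMixed s.n) a b

variable {s τ}

/-- Consecutive terms differ by `evolve` applied to `maxMixed - channel maxMixed`, which is
traceless Hermitian, so the sequence is Cauchy at a geometric rate. The constants do not depend on
`u` or `k`, as continuity in the input requires. -/
theorem IsContractive.exists_uniform_bound (hs : s.IsContractive τ) :
    ∃ r C : ℝ, 0 ≤ r ∧ r < 1 ∧ ∀ u k a b,
      Tendsto (fun m => s.evolve τ u k m (maxMixed s.n) a b) atTop (𝓝 (s.limitState τ u k a b)) ∧
      ∀ m, dist (s.evolve τ u k m (maxMixed s.n) a b) (s.limitState τ u k a b) ≤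
        C * r ^ m / (1 - r) := by
  obtain ⟨ε, hε, hε₁, h⟩ := hs
  -- The size of the first step depends continuously on a single input in the compact interval
  -- `[0,1]`.
  obtain ⟨C, hC⟩ : ∃ C, ∀ x : unitInterval,
      hsNorm (maxMixed s.n - s.channel τ x (maxMixed s.n)) ≤ C := by
    have hcont : Continuous fun x : unitInterval =>
        hsNorm (maxMixed s.n - s.channel τ x (maxMixed s.n)) :=
      continuous_hsNorm.comp (continuous_const.sub
        (s.continuous_channel τ continuous_id continuous_const))
    obtain ⟨C, hC⟩ := (isCompact_range hcont).bddAbove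
    exact ⟨C, fun x => hC ⟨x, rfl⟩⟩
  have hC₀ : 0 ≤ C := (hsNorm_nonneg _).trans (hC 0)
  have hr₀ : 0 ≤ 1 - ε := by linarith
  have hr₁ : 1 - ε < 1 := by linarith
  refine ⟨1 - ε, C, hr₀, hr₁, fun u k a b => ?_⟩
  have hdist (m : ℕ) : dist (s.evolve τ u k m (maxMixed s.n) a b)
      (s.evolve τ u k (m + 1) (maxMixed s.n) a b) ≤ C * (1 - ε) ^ m := by
    have hherm := (isDensity_maxMixed s.n).1.isHermitian
    rw [evolve, dist_eq_norm, ← Matrix.sub_apply, ← evolve_sub]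
    refine (norm_entry_le_hsNorm _ a b).trans ((s.hsNorm_evolve_le τ hr₀ h u k m
      (hherm.sub (s.isHermitian_channel τ _ hherm)) ?_).trans ?_)
    · rw [Matrix.trace_sub, trace_channel, sub_self]
    · rw [mul_comm C]
      exact mul_le_mul (pow_le_pow_of_le_one hr₀ hr₁.le m.le_succ) (hC _) (hsNorm_nonneg _)
        (pow_nonneg hr₀ _)
  have hlim := (cauchySeq_of_le_geometric _ _ hr₁ hdist).tendsto_limUnder
  exact ⟨hlim, dist_le_of_le_geometric_of_tendsto _ _ hr₁ hdist hlim⟩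

/-- The difference from the trajectory of the maximally mixed state starts traceless Hermitian,
hence tends to 0. -/
theorem IsContractive.tendsto_evolve (hs : s.IsContractive τ) (u : ℤ → unitInterval) (k : ℤ)
    {ρ : Op (Reg s.n)} (hρ : ρ.IsHermitian) (hρ₁ : ρ.trace = 1) :
    Tendsto (fun m => s.evolve τ u k m ρ) atTop (𝓝 (s.limitState τ u k)) := by
  obtain ⟨_, _, _, _, hlim⟩ := hs.exists_uniform_bound
  obtain ⟨ε, hε, hε₁, h⟩ := hs
  refine tendsto_pi_nhds.2 fun a => tendsto_pi_nhds.2 fun b => ?_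
  have hzero : Tendsto (fun m => s.evolve τ u k m (ρ - maxMixed s.n) a b) atTop (𝓝 0) := by
    refine squeeze_zero_norm (a := fun m => (1 - ε) ^ (m + 1) * hsNorm (ρ - maxMixed s.n))
      (fun m => ?_) ?_
    · refine (norm_entry_le_hsNorm _ a b).trans (s.hsNorm_evolve_le τ (by linarith) h u k m
        (hρ.sub (isDensity_maxMixed s.n).1.isHermitian) ?_)
      rw [Matrix.trace_sub, hρ₁, trace_maxMixed, sub_self]
    · have := (tendsto_pow_atTop_nhds_zero_of_lt_one (r := 1 - ε) (by linarith)
        (by linarith)).comp (tendsto_add_atTop_nat 1)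
      simpa using this.mul_const (hsNorm (ρ - maxMixed s.n))
  have hsum := hzero.add (hlim u k a b).1
  simpa [evolve_sub] using hsum

theorem IsContractive.trace_limitState (hs : s.IsContractive τ) (u : ℤ → unitInterval) (k : ℤ) :
    (s.limitState τ u k).trace = 1 := by
  have h := hs.tendsto_evolve u k (isDensity_maxMixed s.n).1.isHermitian (trace_maxMixed s.n)
  have htr : Continuous fun M : Op (Reg s.n) => M.trace := continuous_id.matrix_trace
  refine tendsto_nhds_unique ((htr.tendsto _).comp h) ?_
  simp [Function.comp_def, trace_evolve, trace_maxMixed]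

theorem IsContractive.continuous_limitState (hs : s.IsContractive τ) {X : Type*}
    [TopologicalSpace X] {u : X → ℤ → unitInterval} {k : ℤ}
    (hu : ∀ l, l ≤ k → Continuous fun x => u x l) :
    Continuous fun x => s.limitState τ (u x) k := by
  obtain ⟨r, C, hr₀, hr₁, h⟩ := hs.exists_uniform_bound
  refine continuous_matrix fun a b => ?_
  have hbound : Tendsto (fun m : ℕ => C * r ^ m / (1 - r)) atTop (𝓝 0) := by
    simpa using ((tendsto_pow_atTop_nhds_zero_of_lt_one hr₀ hr₁).const_mul C).div_const (1 - r)
  have hunif : TendstoUniformly (fun m x => s.evolve τ (u x) k m (maxMixed s.n) a b)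
      (fun x => s.limitState τ (u x) k a b) atTop := by
    refine Metric.tendstoUniformly_iff.2 fun δ hδ => ?_
    filter_upwards [hbound.eventually_lt_const hδ] with m hm x
    rw [dist_comm]
    exact ((h (u x) k a b).2 m).trans_lt hm
  exact hunif.continuous (Frequently.of_forall fun m =>
    (s.continuous_evolve τ hu m continuous_const).matrix_elem a b)

end Subsystem

/-! ### The filter induced by a system -/

namespace QSystem

theorem continuous_output (S : QSystem) : Continuous S.output := by
  refine (MvPolynomial.continuous_eval S.poly).comp (continuous_pi fun i => ?_)
  exact Complex.continuous_re.comp (continuous_id.mul continuous_const).matrix_trace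

variable {S : QSystem} {τ : ℝ} {A : Set ℝ}

/-- The filter induced by a system of contractive subsystems. -/
noncomputable def inducedFilter (S : QSystem) (τ : ℝ) (u : ℤ → unitInterval) (k : ℤ) : ℝ :=
  S.output (tensorOp (κ := fun K => Reg (S.sub K).n) fun K => (S.sub K).limitState τ u k)

/-- Writes `M u k` as a limit of explicit outputs from one fixed initial state. Uniqueness,
causality and time invariance then follow from uniqueness of limits. -/
theorem Induces.tendsto_output {M : (ℤ → unitInterval) → ℤ → ℝ} (hM : S.Induces τ M)
    (u : ℤ → unitInterval) (k : ℤ) : Tendsto (fun m => S.output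
      (S.state τ u k m fun K => maxMixed (S.sub K).n)) atTop (𝓝 (M u k)) := by
  obtain ⟨ρlim, hlim, h⟩ := hM u k _ fun K => isDensity_maxMixed (S.sub K).n
  rw [h]
  exact (S.continuous_output.tendsto _).comp hlim

theorem Induces.unique {M M' : (ℤ → unitInterval) → ℤ → ℝ} (hM : S.Induces τ M)
    (hM' : S.Induces τ M') : M = M' :=
  funext fun u => funext fun k =>
    tendsto_nhds_unique (hM.tendsto_output u k) (hM'.tendsto_output u k)

theorem Induces.isCausal {M : (ℤ → unitInterval) → ℤ → ℝ} (hM : S.Induces τ M) :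
    IsCausal M := by
  intro u v k h
  refine tendsto_nhds_unique (hM.tendsto_output u k) ?_
  simpa only [state, fun K m => (S.sub K).evolve_congr τ h m] using hM.tendsto_output v k

theorem Induces.isTimeInvariant {M : (ℤ → unitInterval) → ℤ → ℝ} (hM : S.Induces τ M) :
    IsTimeInvariant M := by
  intro u t k
  refine tendsto_nhds_unique (hM.tendsto_output _ k) ?_
  simpa only [state, Subsystem.evolve_shift] using hM.tendsto_output u (k - t)

theorem InClass.induces (hS : S.InClass τ A) : S.Induces τ (S.inducedFilter τ) := by
  intro u k ρ hρ
  refine ⟨_, (continuous_tensorOp.tendsto _).comp (tendsto_pi_nhds.2 fun K => ?_), rfl⟩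
  exact (hS K).2.tendsto_evolve u k (hρ K).1.isHermitian (hρ K).2

theorem InClass.continuous_inducedFilter (hS : S.InClass τ A) {X : Type*} [TopologicalSpace X]
    {u : X → ℤ → unitInterval} {k : ℤ} (hu : ∀ l, l ≤ k → Continuous fun x => u x l) :
    Continuous fun x => S.inducedFilter τ (u x) k :=
  S.continuous_output.comp (continuous_tensorOp.comp (continuous_pi fun K =>
    (hS K).2.continuous_limitState hu))

theorem InClass.expZ_limit (hS : S.InClass τ A) (u : ℤ → unitInterval) (k : ℤ)
    (i : Σ K : Fin S.N, Fin (S.sub K).n) :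
    S.expZ (tensorOp (κ := fun K => Reg (S.sub K).n) fun K => (S.sub K).limitState τ u k) i =
      ((S.sub i.1).limitState τ u k * atSite i.2 pauliZ).trace.re := by
  rw [expZ, trace_tensorOp_mul_atSite]
  exact fun j _ => (hS j).2.trace_limitState u k

end QSystem

/-! ### The space of past inputs -/

namespace PastInput

variable {w : NullSequence}

/-- The weights make the remote past negligible uniformly, and only finitely many coordinates remain
to be controlled. -/
theorem continuous_mk : Continuous (PastInput.mk : (NonposInt → unitInterval) → PastInput w) := by
  refine continuous_iff_continuousAt.2 fun u => Metric.tendsto_nhds.2 fun ε hε => ?_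
  -- Times `k ≤ -n` contribute at most `w_n < ε / 2`, since the inputs differ by at most 1.
  obtain ⟨n, hn⟩ := (w.lim.eventually_lt_const (half_pos hε)).exists
  have hfin : {k : NonposInt | -(n : ℤ) < k}.Finite :=
    Set.Finite.preimage Subtype.val_injective.injOn (Set.finite_Ioc (-(n : ℤ)) 0) |>.subset
      fun k hk => ⟨hk, k.2⟩
  have hclose : ∀ᶠ v in 𝓝 u, ∀ k ∈ {k : NonposInt | -(n : ℤ) < k},
      dist (v k) (u k) < ε / 2 :=
    (eventually_all_finite hfin).2 fun k _ =>
      Metric.tendsto_nhds.1 ((continuous_apply k).tendsto u) _ (half_pos hε)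
  filter_upwards [hclose] with v hv
  have : Nonempty NonposInt := ⟨⟨0, Set.mem_Iic.mpr le_rfl⟩⟩
  refine lt_of_le_of_lt (ciSup_le fun k => ?_) (half_lt_self hε)
  by_cases hk : -(n : ℤ) < k
  · refine (mul_le_of_le_one_right (abs_nonneg _) (w.le_one _)).trans (hv k hk).le
  · refine (mul_le_of_le_one_left (w.pos _).le ?_).trans ((w.anti ?_).trans hn.le)
    · rw [abs_le]
      constructor <;> linarith [(u k).2.1, (u k).2.2, (v k).2.1, (v k).2.2]
    · omega

instance : CompactSpace (PastInput w) where
  isCompact_univ := by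
    have h : Set.range (PastInput.mk : (NonposInt → unitInterval) → PastInput w) = Set.univ :=
      Set.range_eq_univ.2 fun u => ⟨u.seq, rfl⟩
    exact h ▸ isCompact_range continuous_mk

theorem continuous_seq_apply (k : NonposInt) : Continuous fun u : PastInput w => u.seq k := by
  refine Continuous.subtype_mk (f := fun u : PastInput w => ((u.seq k : unitInterval) : ℝ)) ?_ _
  set c := w.val (-(k : ℤ)).toNat
  have hc : 0 < c := w.pos _
  refine (LipschitzWith.of_dist_le_mul (K := NNReal.mk c⁻¹ (inv_pos.2 hc).le)
    fun u v => ?_).continuous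
  rw [NNReal.coe_mk, inv_mul_eq_div, le_div_iff₀ hc]
  exact le_dist u v k

theorem continuous_extendInput (l : ℤ) : Continuous fun u : PastInput w => extendInput u.seq l := by
  unfold extendInput
  split_ifs
  · exact continuous_seq_apply _
  · exact continuous_const

end PastInput

/-! ### Two qubits with an exchange interaction -/

theorem sum_reg_two {M : Type*} [AddCommMonoid M] (f : Reg 2 → M) :
    ∑ a, f a = f ![0, 0] + f ![1, 0] + (f ![0, 1] + f ![1, 1]) := by
  simp [sum_reg_succ, Fin.sum_univ_two, Matrix.empty_eq]

theorem forall_reg_two {p : Reg 2 → Prop} :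
    (∀ a, p a) ↔ p ![0, 0] ∧ p ![0, 1] ∧ p ![1, 0] ∧ p ![1, 1] := by
  refine ⟨fun h => ⟨h _, h _, h _, h _⟩, fun ⟨h₀, h₁, h₂, h₃⟩ a => ?_⟩
  obtain ⟨i, j, rfl⟩ : ∃ i j, a = ![i, j] := ⟨a 0, a 1, by ext l; fin_cases l <;> rfl⟩
  fin_cases i <;> fin_cases j <;> assumption

/-- The two-qubit operator with `p` at `|00⟩⟨00|`, `q` at `|11⟩⟨11|`, and the block
`(c, d; d, c)` on the span of `|01⟩` and `|10⟩`. -/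
def exchangeOp (p q c d : ℂ) : Op (Reg 2) := fun a b =>
  if a = b then if a 0 = a 1 then if a 0 = 0 then p else q else c
  else if a 0 = b 1 ∧ a 1 = b 0 then d else 0

/-- Eigenvectors of the operators `exchangeOp p q c d`, as columns. -/
def exchangeBasis : Op (Reg 2) := fun a b =>
  if a = b then if a = ![1, 0] then -1 else 1
  else if a 0 = b 1 ∧ a 1 = b 0 then 1 else 0

/-- On the span of `|01⟩` and `|10⟩` the eigenvectors are `(1, 1)` and `(1, -1)`, with eigenvalues
`x` and `y`. The basis matrix is symmetric and its square is diagonal with entries 1 and 2, so the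
last factor is its inverse. -/
theorem exchangeBasis_mul_diagonal_mul (p q x y : ℂ) :
    exchangeBasis * Matrix.diagonal (fun a : Reg 2 => if a 0 = a 1 then if a 0 = 0 then p else q
      else if a 0 = 0 then x else y) *
      (exchangeBasis * Matrix.diagonal (fun a : Reg 2 => if a 0 = a 1 then 1 else 2⁻¹)) =
    exchangeOp p q ((x + y) / 2) ((x - y) / 2) := by
  rw [← Matrix.ext_iff]
  simp only [forall_reg_two]
  simp [Matrix.mul_apply, Matrix.diagonal_apply, sum_reg_two, exchangeBasis,
    exchangeOp]
  refine ⟨⟨?_, ?_⟩, ?_, ?_⟩ <;> ring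

theorem exp_exchangeOp (p q d : ℂ) : NormedSpace.exp (exchangeOp p q 0 d) =
    exchangeOp (Complex.exp p) (Complex.exp q) (Complex.cosh d) (Complex.sinh d) := by
  -- With all eigenvalues equal to 1, the identity exhibits the inverse of `exchangeBasis`.
  have h₁ := exchangeBasis_mul_diagonal_mul 1 1 1 1
  have hdiag : (fun a : Reg 2 => if a 0 = a 1 then if a 0 = 0 then (1 : ℂ) else 1
      else if a 0 = 0 then 1 else 1) = fun _ => 1 := by simp
  have hone : exchangeOp 1 1 ((1 + 1) / 2) ((1 - 1) / 2) = 1 := by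
    rw [← Matrix.ext_iff]
    simp only [forall_reg_two]
    simp [exchangeOp]
  rw [hdiag, hone, Matrix.diagonal_one, mul_one] at h₁
  have hinv := Matrix.inv_eq_right_inv h₁
  have h₂ := exchangeBasis_mul_diagonal_mul p q d (-d)
  rw [add_neg_cancel, zero_div, sub_neg_eq_add, add_self_div_two, ← hinv] at h₂
  rw [← h₂, Matrix.exp_conj _ _ (IsUnit.of_mul_eq_one _ h₁), Matrix.exp_diagonal, hinv,
    Complex.cosh, Complex.sinh, ← exchangeBasis_mul_diagonal_mul]
  congr 4
  funext a
  rw [Pi.coe_exp, ← Complex.exp_eq_exp_ℂ]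
  split_ifs <;> rfl

/-! ### Subsystems with a single system qubit -/

/-- One system qubit, coupled to the ancilla by `J`. -/
def qubit (J α : ℝ) : Subsystem := ⟨1, one_pos, fun _ _ => J, α⟩

theorem atSite_zero_mul_atSite_one (P Q : Op (Fin 2)) (a b : Reg 2) :
    (atSite (κ := fun _ : Fin 2 => Fin 2) 0 P * atSite (κ := fun _ : Fin 2 => Fin 2) 1 Q) a b =
      P (a 0) (b 0) * Q (a 1) (b 1) := by
  rw [atSite_eq_tensorOp, atSite_eq_tensorOp, tensorOp_mul]
  simp [tensorOp, Fin.prod_univ_two]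

theorem hamiltonian_qubit (J α : ℝ) :
    (qubit J α).hamiltonian = exchangeOp (2 * α) (-(2 * α)) 0 (2 * J) := by
  change (∑ j₁ : Fin 2, ∑ j₂ ∈ Finset.Ioi j₁, (J : ℂ) •
      (atSite (κ := fun _ => Fin 2) j₁ pauliX * atSite (κ := fun _ => Fin 2) j₂ pauliX +
        atSite (κ := fun _ => Fin 2) j₁ pauliY * atSite (κ := fun _ => Fin 2) j₂ pauliY)) +
    ∑ j : Fin 2, (α : ℂ) • atSite (κ := fun _ => Fin 2) j pauliZ = _
  have h0 : Finset.Ioi (0 : Fin 2) = {1} := rfl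
  have h1 : Finset.Ioi (1 : Fin 2) = ∅ := rfl
  rw [Fin.sum_univ_two, Fin.sum_univ_two, h0, h1, Finset.sum_singleton, Finset.sum_empty,
    add_zero, ← Matrix.ext_iff]
  simp only [Matrix.add_apply, Matrix.smul_apply, atSite_zero_mul_atSite_one, forall_reg_two]
  simp [atSite, pauliX, pauliY, pauliZ, exchangeOp, Fin.forall_fin_two]
  refine ⟨?_, ?_, ?_⟩ <;> ring

theorem exp_hamiltonian_qubit (J α : ℝ) (c : ℂ) :
    NormedSpace.exp (c • (qubit J α).hamiltonian) =
      exchangeOp (Complex.exp (c * (2 * α))) (Complex.exp (-(c * (2 * α))))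
        (Complex.cosh (c * (2 * J))) (Complex.sinh (c * (2 * J))) := by
  have h : c • exchangeOp (2 * α) (-(2 * α)) 0 (2 * J) =
      exchangeOp (c * (2 * α)) (-(c * (2 * α))) 0 (c * (2 * J)) := by
    rw [← Matrix.ext_iff]
    simp only [forall_reg_two]
    simp [exchangeOp]
  rw [hamiltonian_qubit, ← exp_exchangeOp, ← h]
  rfl

theorem forall_reg_one {p : Reg 1 → Prop} : (∀ a, p a) ↔ p ![0] ∧ p ![1] := by
  refine ⟨fun h => ⟨h _, h _⟩, fun ⟨h₀, h₁⟩ a => ?_⟩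
  obtain ⟨i, rfl⟩ : ∃ i, a = ![i] := ⟨a 0, by ext l; fin_cases l; rfl⟩
  fin_cases i <;> assumption

theorem sum_reg_one {M : Type*} [AddCommMonoid M] (f : Reg 1 → M) :
    ∑ a, f a = f ![0] + f ![1] := by
  simp [sum_reg_succ, Fin.sum_univ_two, Matrix.empty_eq]

/-- The coefficients are left arbitrary so that this stays a polynomial identity, free of
exponentials. -/
theorem traceAncilla_exchangeOp_conj (p q c d p' q' c' d' : ℂ) (u : unitInterval)
    (ρ : Op (Reg 1)) (a b : Reg 1) :
    traceAncilla (exchangeOp p q c d * attachAncilla ρ (ancillaState u) *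
      exchangeOp p' q' c' d') a b =
        if a = b then if a = ![0] then
            (p * p' * (u : ℝ) + c * c' * (1 - (u : ℝ))) * ρ ![0] ![0] +
              d * d' * (u : ℝ) * ρ ![1] ![1]
          else d * d' * (1 - (u : ℝ)) * ρ ![0] ![0] +
            (c * c' * (u : ℝ) + q * q' * (1 - (u : ℝ))) * ρ ![1] ![1]
        else if a = ![0] then (p * c' * (u : ℝ) + c * q' * (1 - (u : ℝ))) * ρ ![0] ![1]
          else (c * p' * (u : ℝ) + q * c' * (1 - (u : ℝ))) * ρ ![1] ![0] := by
  revert a b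
  simp only [forall_reg_one]
  simp [Matrix.mul_apply, sum_reg_two, traceAncilla, attachAncilla, ancillaState, exchangeOp]
  have hconst (i : Fin 2) : (fun _ : Fin 1 => i) = ![i] := by
    ext l
    fin_cases l
    rfl
  simp only [hconst]
  refine ⟨⟨?_, ?_⟩, ?_, ?_⟩ <;> ring

/-- The channel of `qubit J α`, as a map between operators on `Reg 1`. -/
noncomputable def qubitChannel (J α τ : ℝ) (u : unitInterval) (ρ : Op (Reg 1)) : Op (Reg 1) :=
  (qubit J α).channel τ u ρ

theorem qubitChannel_eq (J α τ : ℝ) (u : unitInterval) (ρ : Op (Reg 1)) :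
    qubitChannel J α τ u ρ = traceAncilla
      (exchangeOp (Complex.exp (-(Complex.I * τ) * (2 * α)))
        (Complex.exp (-(-(Complex.I * τ) * (2 * α))))
        (Complex.cosh (-(Complex.I * τ) * (2 * J))) (Complex.sinh (-(Complex.I * τ) * (2 * J))) *
      attachAncilla ρ (ancillaState u) *
      exchangeOp (Complex.exp (Complex.I * τ * (2 * α))) (Complex.exp (-(Complex.I * τ * (2 * α))))
        (Complex.cosh (Complex.I * τ * (2 * J))) (Complex.sinh (Complex.I * τ * (2 * J)))) := by
  rw [← exp_hamiltonian_qubit, ← exp_hamiltonian_qubit]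
  rfl

/-- The exchange interaction is a partial swap with the ancilla: the diagonal is mixed with the
ancilla state with weights `cos²` and `sin²`, while the coherences are damped by `cos` and rotated
by a phase. Only that phase involves `α`. -/
theorem qubitChannel_apply (J α τ : ℝ) (u : unitInterval) (ρ : Op (Reg 1)) (a b : Reg 1) :
    qubitChannel J α τ u ρ a b =
      if a = b then (Real.cos (2 * J * τ) : ℂ) ^ 2 * ρ a a +
        (Real.sin (2 * J * τ) : ℂ) ^ 2 * ancillaState u (a 0) (a 0) * ρ.trace
      else (Real.cos (2 * J * τ) : ℂ) *
        Complex.exp (((if a = ![0] then -(2 * α * τ) else 2 * α * τ : ℝ) : ℂ) * Complex.I) *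
          ρ a b := by
  have hpos : Complex.I * τ * (2 * J) = ((2 * J * τ : ℝ) : ℂ) * Complex.I := by push_cast; ring
  have hneg : -(Complex.I * τ) * (2 * J) = -(((2 * J * τ : ℝ) : ℂ) * Complex.I) := by
    push_cast; ring
  have hpα : Complex.I * τ * (2 * α) = ((2 * α * τ : ℝ) : ℂ) * Complex.I := by push_cast; ring
  have hnα : -(Complex.I * τ) * (2 * α) = -(((2 * α * τ : ℝ) : ℂ) * Complex.I) := by
    push_cast; ring
  rw [qubitChannel_eq, traceAncilla_exchangeOp_conj, hpos, hneg, hpα, hnα,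
    Complex.cosh_neg, Complex.sinh_neg, Complex.cosh_mul_I, Complex.sinh_mul_I, neg_neg]
  simp only [Matrix.trace, Matrix.diag_apply, sum_reg_one, Complex.ofReal_cos, Complex.ofReal_sin]
  generalize ((2 * J * τ : ℝ) : ℂ) = θ at *
  generalize (2 * α * τ : ℝ) = φ at *
  have hcs := Complex.sin_sq_add_cos_sq θ
  have hexp : Complex.exp (φ * Complex.I) * Complex.exp (-(φ * Complex.I)) = 1 := by
    rw [← Complex.exp_add, add_neg_cancel, Complex.exp_zero]
  revert a b
  simp only [forall_reg_one]
  simp [ancillaState]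
  generalize Complex.exp (φ * Complex.I) = e at *
  generalize Complex.exp (-(φ * Complex.I)) = e' at *
  refine ⟨⟨?_, Or.inl (by ring)⟩, Or.inl (by ring), ?_⟩
  · linear_combination (u : ℂ) * ρ ![0] ![0] * (hexp - hcs) -
      Complex.sin θ ^ 2 * u * ρ ![1] ![1] * Complex.I_sq
  · linear_combination (1 - (u : ℂ)) * ρ ![1] ![1] * (hexp - hcs) -
      Complex.sin θ ^ 2 * (1 - u) * ρ ![0] ![0] * Complex.I_sq

/-- The expectation of `Z` for a single qubit. -/
noncomputable def qubitExpZ (ρ : Op (Reg 1)) : ℝ :=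
  (ρ * atSite (κ := fun _ : Fin 1 => Fin 2) 0 pauliZ).trace.re

theorem trace_mul_atSite_pauliZ (ρ : Op (Reg 1)) :
    (ρ * atSite (κ := fun _ : Fin 1 => Fin 2) 0 pauliZ).trace = ρ ![0] ![0] - ρ ![1] ![1] := by
  simp [Matrix.trace, Matrix.mul_apply, sum_reg_one, atSite, pauliZ, sub_eq_add_neg]

theorem qubitExpZ_eq (ρ : Op (Reg 1)) : qubitExpZ ρ = (ρ ![0] ![0] - ρ ![1] ![1]).re := by
  rw [qubitExpZ, trace_mul_atSite_pauliZ]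

theorem qubitExpZ_qubitChannel (J α τ : ℝ) (u : unitInterval) {ρ : Op (Reg 1)}
    (hρ : ρ.trace = 1) :
    qubitExpZ (qubitChannel J α τ u ρ) = Real.cos (2 * J * τ) ^ 2 * qubitExpZ ρ +
      (1 - Real.cos (2 * J * τ) ^ 2) * (2 * u - 1) := by
  have h : qubitChannel J α τ u ρ ![0] ![0] - qubitChannel J α τ u ρ ![1] ![1] =
      ((Real.cos (2 * J * τ) ^ 2 : ℝ) : ℂ) * (ρ ![0] ![0] - ρ ![1] ![1]) +
        ((Real.sin (2 * J * τ) ^ 2 * (2 * u - 1) : ℝ) : ℂ) := by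
    rw [qubitChannel_apply, qubitChannel_apply, if_pos rfl, if_pos rfl, hρ]
    simp [ancillaState]
    ring
  rw [qubitExpZ_eq, qubitExpZ_eq, h, Complex.add_re, Complex.re_ofReal_mul, Complex.ofReal_re,
    Real.sin_sq]

theorem continuous_qubitExpZ : Continuous qubitExpZ :=
  Complex.continuous_re.comp (continuous_id.mul continuous_const).matrix_trace

/-- For trace 0 the ancilla term vanishes, and every entry shrinks by `|cos|` or, on the diagonal,
by `cos² ≤ |cos|`. -/
theorem hsNorm_qubitChannel_le {J α τ : ℝ} (u : unitInterval) {B : Op (Reg 1)}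
    (hB₀ : B.trace = 0) :
    hsNorm (qubitChannel J α τ u B) ≤ |Real.cos (2 * J * τ)| * hsNorm B := by
  have hentry (a b : Reg 1) :
      ‖qubitChannel J α τ u B a b‖ ≤ |Real.cos (2 * J * τ)| * ‖B a b‖ := by
    rw [qubitChannel_apply, hB₀]
    split_ifs with hab
    · subst hab
      rw [mul_zero, add_zero, norm_mul, norm_pow, Complex.norm_real, Real.norm_eq_abs, sq]
      exact mul_le_mul_of_nonneg_right
        (mul_le_of_le_one_right (abs_nonneg _) (Real.abs_cos_le_one _)) (norm_nonneg _)
    all_goals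
      rw [norm_mul, norm_mul, Complex.norm_exp_ofReal_mul_I, Complex.norm_real, Real.norm_eq_abs,
        mul_one]
  have hsum : ∑ j, ∑ i, ‖qubitChannel J α τ u B i j‖ ^ 2 ≤
      |Real.cos (2 * J * τ)| ^ 2 * ∑ j, ∑ i, ‖B i j‖ ^ 2 := by
    simp only [Finset.mul_sum, ← mul_pow]
    exact Finset.sum_le_sum fun j _ => Finset.sum_le_sum fun i _ =>
      pow_le_pow_left₀ (norm_nonneg _) (hentry i j) 2
  rw [hsNorm_eq, hsNorm_eq]
  refine (Real.sqrt_le_sqrt hsum).trans_eq ?_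
  rw [Real.sqrt_mul (sq_nonneg _), Real.sqrt_sq (abs_nonneg _)]

theorem isContractive_qubit {J α τ : ℝ} (h : |Real.cos (2 * J * τ)| < 1) :
    (qubit J α).IsContractive τ := by
  refine ⟨1 - |Real.cos (2 * J * τ)|, by linarith, by linarith [abs_nonneg (Real.cos (2 * J * τ))],
    fun u B _ hB₀ => ?_⟩
  rw [sub_sub_cancel]
  exact hsNorm_qubitChannel_le u hB₀

/-! ### The output of a single qubit -/

/-- The expectation of `Z` in the limit state of `qubit J α`. -/
noncomputable def qubitOutput (J α τ : ℝ) (u : ℤ → unitInterval) (k : ℤ) : ℝ :=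
  qubitExpZ ((qubit J α).limitState τ u k)

section QubitOutput

variable {J α τ : ℝ}

theorem tendsto_qubitOutput (h : |Real.cos (2 * J * τ)| < 1) (u : ℤ → unitInterval) (k : ℤ) :
    Tendsto (fun m => qubitExpZ ((qubit J α).evolve τ u k m (maxMixed 1))) atTop
      (𝓝 (qubitOutput J α τ u k)) :=
  (continuous_qubitExpZ.tendsto _).comp
    ((isContractive_qubit h).tendsto_evolve u k (isDensity_maxMixed 1).1.isHermitian
      (trace_maxMixed 1))

theorem qubitExpZ_evolve_succ (u : ℤ → unitInterval) (k : ℤ) (m : ℕ) :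
    qubitExpZ ((qubit J α).evolve τ u k (m + 1) (maxMixed 1)) = Real.cos (2 * J * τ) ^ 2 *
      qubitExpZ ((qubit J α).evolve τ u (k - 1) m (maxMixed 1)) +
        (1 - Real.cos (2 * J * τ) ^ 2) * (2 * u k - 1) := by
  refine (congrArg qubitExpZ ((qubit J α).evolve_succ τ u k m (maxMixed 1))).trans ?_
  exact qubitExpZ_qubitChannel J α τ (u k)
    (((qubit J α).trace_evolve τ u (k - 1) m (maxMixed 1)).trans (trace_maxMixed 1))

theorem qubitOutput_eq (h : |Real.cos (2 * J * τ)| < 1) (u : ℤ → unitInterval) (k : ℤ) :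
    qubitOutput J α τ u k = Real.cos (2 * J * τ) ^ 2 * qubitOutput J α τ u (k - 1) +
      (1 - Real.cos (2 * J * τ) ^ 2) * (2 * u k - 1) := by
  refine tendsto_nhds_unique ((tendsto_qubitOutput h u k).comp (tendsto_add_atTop_nat 1)) ?_
  refine (((tendsto_qubitOutput h u (k - 1)).const_mul _).add_const _).congr fun m => ?_
  exact (qubitExpZ_evolve_succ u k m).symm

theorem abs_convexCombination_le {q z x : ℝ} (hq₀ : 0 ≤ q) (hq₁ : q ≤ 1) (hz : |z| ≤ 1)
    (hx₀ : 0 ≤ x) (hx₁ : x ≤ 1) : |q * z + (1 - q) * (2 * x - 1)| ≤ 1 := by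
  rw [abs_le] at hz ⊢
  constructor <;> nlinarith

theorem abs_qubitOutput_le (h : |Real.cos (2 * J * τ)| < 1) (u : ℤ → unitInterval) (k : ℤ) :
    |qubitOutput J α τ u k| ≤ 1 := by
  refine le_of_tendsto (tendsto_qubitOutput (α := α) h u k).abs (Eventually.of_forall fun m => ?_)
  have hq := Real.cos_sq_le_one (2 * J * τ)
  induction m generalizing k with
  | zero =>
    refine (congrArg abs (qubitExpZ_qubitChannel J α τ (u k) (trace_maxMixed 1))).trans_le
      (abs_convexCombination_le (sq_nonneg _) hq ?_ (u k).2.1 (u k).2.2)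
    rw [qubitExpZ_eq]
    simp [maxMixed]
  | succ m ih =>
    exact (congrArg abs (qubitExpZ_evolve_succ u k m)).trans_le
      (abs_convexCombination_le (sq_nonneg _) hq (ih _) (u k).2.1 (u k).2.2)

theorem exists_abs_cos_lt_one_eq {τ c : ℝ} (hτ : 0 < τ) (hc₀ : 0 ≤ c) (hc₁ : c < 1) :
    ∃ J : ℝ, |Real.cos (2 * J * τ)| < 1 ∧ Real.cos (2 * J * τ) = c := by
  have hcos : Real.cos (2 * (Real.arccos c / (2 * τ)) * τ) = c := by
    rw [show 2 * (Real.arccos c / (2 * τ)) * τ = Real.arccos c by field_simp]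
    exact Real.cos_arccos (by linarith) hc₁.le
  exact ⟨_, by rwa [hcos, abs_of_nonneg hc₀], hcos⟩

/-- Inputs that differ at some time `k ≤ 0` are distinguished by the output of a single qubit. -/
theorem exists_qubitOutput_ne (α : ℝ) (hτ : 0 < τ) {u v : ℤ → unitInterval}
    (huv : ∃ n : ℕ, u (-n) ≠ v (-n)) :
    ∃ J, |Real.cos (2 * J * τ)| < 1 ∧ qubitOutput J α τ u 0 ≠ qubitOutput J α τ v 0 := by
  classical
  -- `-n` is the most recent time at which the inputs differ.
  obtain ⟨n, hn, hmin⟩ : ∃ n : ℕ, u (-n) ≠ v (-n) ∧ ∀ m : ℕ, m < n → u (-m) = v (-m) :=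
    ⟨Nat.find huv, Nat.find_spec huv, fun m hm => not_not.1 (Nat.find_min huv hm)⟩
  set d : ℝ := |(u (-n) : ℝ) - v (-n)|
  have hd₀ : 0 < d := abs_pos.2 (sub_ne_zero.2 fun h => hn (Subtype.ext h))
  have hd₁ : d ≤ 1 := by
    rw [abs_le]
    constructor <;> linarith [(u (-n)).2.1, (u (-n)).2.2, (v (-n)).2.1, (v (-n)).2.2]
  -- This gives `q = d² / 4`: positive, so the recursion can be run backwards, and small enough for
  -- the final contradiction.
  obtain ⟨J, hJ, hcos⟩ := exists_abs_cos_lt_one_eq hτ (c := d / 2) (by linarith) (by linarith)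
  refine ⟨J, hJ, fun heq => ?_⟩
  -- While the inputs agree, equal outputs at one time force equal outputs one step earlier, after
  -- cancelling `q ≠ 0`.
  have hall (m : ℕ) (hm : m ≤ n) : qubitOutput J α τ u (-m) = qubitOutput J α τ v (-m) := by
    induction m with
    | zero => simpa using heq
    | succ m ih =>
      have h := ih (by omega)
      rw [qubitOutput_eq hJ, qubitOutput_eq hJ v, hmin m (by omega), hcos] at h
      have h' := mul_left_cancel₀ (by positivity) (add_right_cancel h)
      rwa [show -((m + 1 : ℕ) : ℤ) = -m - 1 by push_cast; ring]
  have h := hall n le_rfl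
  rw [qubitOutput_eq hJ, qubitOutput_eq hJ v, hcos] at h
  have hu := abs_le.1 (abs_qubitOutput_le (α := α) hJ u (-n - 1))
  have hv := abs_le.1 (abs_qubitOutput_le (α := α) hJ v (-n - 1))
  -- At time `-n` the left side has size `2 (1 - q) d`, while the right side is at most `2 q`, since
  -- outputs lie in `[-1, 1]`.
  have hdiff : 2 * (1 - (d / 2) ^ 2) * ((u (-n) : ℝ) - v (-n)) = (d / 2) ^ 2 *
      (qubitOutput J α τ v (-n - 1) - qubitOutput J α τ u (-n - 1)) := by linear_combination h
  have hq : 0 ≤ 2 * (1 - (d / 2) ^ 2) := by nlinarith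
  have habs := congrArg abs hdiff
  rw [abs_mul _ ((u (-n) : ℝ) - v (-n)), abs_mul ((d / 2) ^ 2), abs_of_nonneg hq,
    abs_of_nonneg (sq_nonneg (d / 2))] at habs
  have hle : |qubitOutput J α τ v (-n - 1) - qubitOutput J α τ u (-n - 1)| ≤ 2 := by
    rw [abs_le]
    constructor <;> linarith
  have h₁ := mul_le_mul_of_nonneg_left hle (sq_nonneg (d / 2))
  -- As `0 < d ≤ 1`, `2 q ≤ d / 2`, whereas `2 (1 - q) d ≥ 3 d / 2`.
  have h₂ : (d / 2) ^ 2 ≤ d / 4 := by nlinarith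
  have h₃ : 2 * (1 - d / 4) * d ≤ 2 * (1 - (d / 2) ^ 2) * d := by nlinarith
  nlinarith

end QubitOutput

/-! ### Density of the induced functionals -/

/-- The couplings for which a single qubit is contractive. -/
def contractiveCouplings (τ : ℝ) : Set ℝ := {J | |Real.cos (2 * J * τ)| < 1}

/-- The output of a single qubit at time `0`, as a function of the past input. -/
noncomputable def qubitFunctional (w : NullSequence) (α τ : ℝ) (J : contractiveCouplings τ) :
    C(PastInput w, ℝ) where
  toFun u := qubitOutput J α τ (extendInput u.seq) 0
  continuous_toFun := continuous_qubitExpZ.comp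
    ((isContractive_qubit J.2).continuous_limitState fun l _ => PastInput.continuous_extendInput l)

/-- A system of single qubits, with output a polynomial in the expectations `⟨Z⟩`. -/
noncomputable def qubitSystem (α : ℝ) {n : ℕ} (J : Fin (n + 1) → ℝ)
    (p : MvPolynomial (Fin (n + 1)) ℝ) : QSystem where
  N := n + 1
  N_pos := n.succ_pos
  sub K := qubit (J K) α
  poly := MvPolynomial.rename (fun K => ⟨K, (0 : Fin 1)⟩) p

theorem inClass_qubitSystem {α τ : ℝ} {A : Set ℝ} (hα : α ∈ A) {n : ℕ}
    (J : Fin (n + 1) → contractiveCouplings τ) (p : MvPolynomial (Fin (n + 1)) ℝ) :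
    (qubitSystem α (fun K => (J K : ℝ)) p).InClass τ A :=
  fun K => ⟨hα, isContractive_qubit (J K).2⟩

theorem inducedFilter_qubitSystem (α τ : ℝ) {n : ℕ} (J : Fin (n + 1) → contractiveCouplings τ)
    (p : MvPolynomial (Fin (n + 1)) ℝ) (u : ℤ → unitInterval) (k : ℤ) :
    (qubitSystem α (fun K => (J K : ℝ)) p).inducedFilter τ u k =
      MvPolynomial.eval (fun K => qubitOutput (J K) α τ u k) p := by
  have hS := inClass_qubitSystem (Set.mem_univ α) J p
  rw [QSystem.inducedFilter, QSystem.output, funext (hS.expZ_limit u k)]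
  exact MvPolynomial.eval_rename _ _ _

theorem separatesPoints_qubitFunctional (w : NullSequence) (α : ℝ) {τ : ℝ} (hτ : 0 < τ) :
    (Algebra.adjoin ℝ (Set.range (qubitFunctional w α τ))).SeparatesPoints := by
  intro u v huv
  have hne : ∃ n : ℕ, extendInput u.seq (-n) ≠ extendInput v.seq (-n) := by
    by_contra! h
    refine huv (PastInput.ext (funext fun k => ?_))
    obtain ⟨k, hk⟩ := k
    have hk : k ≤ 0 := hk
    obtain ⟨n, rfl⟩ : ∃ n : ℕ, k = -n := ⟨k.natAbs, by omega⟩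
    simpa [extendInput] using h n
  obtain ⟨J, hJ, hne⟩ := exists_qubitOutput_ne α hτ hne
  exact ⟨_, ⟨_, Algebra.subset_adjoin ⟨⟨J, hJ⟩, rfl⟩, rfl⟩, hne⟩

/-- An element of the algebra is a polynomial in finitely many single-qubit outputs; taking those
qubits as non-interacting subsystems realises it. -/
theorem exists_filter_of_mem_adjoin {w : NullSequence} {α τ : ℝ} (hτ : 0 < τ) {A : Set ℝ}
    (hα : α ∈ A) {F : C(PastInput w, ℝ)}
    (hF : F ∈ Algebra.adjoin ℝ (Set.range (qubitFunctional w α τ))) :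
    ∃ M ∈ inducedFilters τ A, ∀ u : PastInput w, functionalOf M u.seq = F u := by
  rw [Algebra.adjoin_range_eq_range_aeval] at hF
  obtain ⟨P, rfl⟩ := hF
  obtain ⟨n, f, -, p, rfl⟩ := P.exists_fin_rename
  -- The polynomial may involve no generator at all, but a system needs at least one subsystem; so a
  -- spare qubit, which the polynomial ignores, is appended.
  obtain ⟨J₀, hJ₀, -⟩ := exists_abs_cos_lt_one_eq hτ le_rfl zero_lt_one
  let J : Fin (n + 1) → contractiveCouplings τ := Fin.snoc f ⟨J₀, hJ₀⟩
  have hS := inClass_qubitSystem hα J (MvPolynomial.rename Fin.castSucc p)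
  refine ⟨_, ⟨_, hS, hS.induces⟩, fun u => ?_⟩
  rw [functionalOf, inducedFilter_qubitSystem, MvPolynomial.eval_rename]
  change _ = ContinuousMap.evalAlgHom ℝ ℝ u (MvPolynomial.aeval _ _)
  rw [MvPolynomial.aeval_rename, MvPolynomial.comp_aeval_apply, MvPolynomial.aeval_eq_eval]
  congr 2
  funext i
  simp only [Function.comp_apply, J, Fin.snoc_castSucc]
  rfl

theorem exists_filter_near (w : NullSequence) {τ : ℝ} (hτ : 0 < τ) {A : Set ℝ} (hA : A.Nonempty)
    (G : C(PastInput w, ℝ)) {ε : ℝ} (hε : 0 < ε) :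
    ∃ M ∈ inducedFilters τ A, ∀ u : PastInput w, |G u - functionalOf M u.seq| < ε := by
  obtain ⟨α, hα⟩ := hA
  obtain ⟨⟨F, hF⟩, hFG⟩ :=
    ContinuousMap.exists_mem_subalgebra_near_continuous_of_separatesPoints _
      (separatesPoints_qubitFunctional w α hτ) G G.continuous ε hε
  obtain ⟨M, hM, hMF⟩ := exists_filter_of_mem_adjoin hτ hα hF
  refine ⟨M, hM, fun u => ?_⟩
  rw [hMF, abs_sub_comm]
  exact hFG u

/-- Shift time `k` to 0; the extension by 0 then alters only future inputs, which causality ignores.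
-/
theorem IsCausal.eq_functionalOf {M : (ℤ → unitInterval) → ℤ → ℝ} (hM : IsCausal M)
    (hM' : IsTimeInvariant M) (u : ℤ → unitInterval) (k : ℤ) :
    M u k = functionalOf M fun l => u (l + k) := by
  have h := hM' u (-k) 0
  rw [zero_sub, neg_neg] at h
  rw [← h]
  refine hM _ _ 0 fun l hl => ?_
  simp [extendInput, hl]

theorem mainTheorem1 (τ : ℝ) (hτ : 0 < τ) (A : Set ℝ) (hA : A.Nonempty) :
    -- every system of the class induces exactly one filter
    (∀ S : QSystem, S.InClass τ A → ∃! M, S.Induces τ M) ∧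
    (∀ M ∈ inducedFilters τ A, IsCausal M ∧ IsTimeInvariant M) ∧
    ∀ w : NullSequence,
      -- the induced functionals form a dense subset of `C(K_1^-([0, 1]), ‖·‖_w)`
      (∀ F ∈ inducedFunctionals τ A, Continuous fun u : PastInput w => F u.seq) ∧
      (∀ G : C(PastInput w, ℝ), ∀ ε : ℝ, 0 < ε →
        ∃ F ∈ inducedFunctionals τ A, ∀ u : PastInput w, |G u - F u.seq| < ε) ∧
      -- the induced filters approximate all fading memory filters uniformly
      (∀ M₀ : (ℤ → unitInterval) → ℤ → ℝ,
        IsCausal M₀ → IsTimeInvariant M₀ → HasFadingMemory w M₀ → ∀ ε : ℝ, 0 < ε →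
          ∃ M ∈ inducedFilters τ A, ∀ u : ℤ → unitInterval,
            BddAbove (Set.range fun k : ℤ => |M₀ u k - M u k|) ∧
              sSup (Set.range fun k : ℤ => |M₀ u k - M u k|) < ε) := by
  have hprop : ∀ M ∈ inducedFilters τ A, IsCausal M ∧ IsTimeInvariant M := by
    rintro M ⟨S, -, hM⟩
    exact ⟨hM.isCausal, hM.isTimeInvariant⟩
  refine ⟨fun S hS => ⟨_, hS.induces, fun M hM => hM.unique hS.induces⟩, hprop,
    fun w => ⟨?_, fun G ε hε => ?_, fun M₀ hc ht hw ε hε => ?_⟩⟩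
  · rintro _ ⟨M, ⟨S, hS, hM⟩, rfl⟩
    rw [hM.unique hS.induces]
    exact hS.continuous_inducedFilter fun l _ => PastInput.continuous_extendInput l
  · obtain ⟨M, hM, h⟩ := exists_filter_near w hτ hA G hε
    exact ⟨_, ⟨M, hM, rfl⟩, h⟩
  · obtain ⟨M, hM, h⟩ := exists_filter_near w hτ hA ⟨_, hw⟩ (half_pos hε)
    have hle (u : ℤ → unitInterval) (k : ℤ) : |M₀ u k - M u k| ≤ ε / 2 := by
      rw [hc.eq_functionalOf ht, (hprop M hM).1.eq_functionalOf (hprop M hM).2]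
      exact (h ⟨fun l => u (l + k)⟩).le
    refine ⟨M, hM, fun u => ⟨⟨ε / 2, Set.forall_mem_range.2 (hle u)⟩, ?_⟩⟩
    exact (csSup_le (Set.range_nonempty _) (Set.forall_mem_range.2 (hle u))).trans_lt
      (half_lt_self hε)
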